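/- All graphs are finite and simple. A graph $G$ is $P_4$-extendible if, for every vertex set $W$ inducing a path $P_4$ on four vertices, there is at most one vertex $v\notin W$ that belongs to some induced $P_4$ of $G$ sharing at least one vertex with $W$. A property $\mathcal P$ of $P_4$-extendible graphs is hereditary if, whenever a $P_4$-extendible graph $G$ has $\mathcal P$, every graph isomorphic to an induced subgraph of $G$ has $\mathcal P$. A minimal $\mathcal P$-obstruction is a graph that does not have $\mathcal P$ but all of whose proper induced subgraphs have $\mathcal P$. **Corollary.** The class of $P_4$-extendible graphs is well-quasi-ordered under the induced subgraph relation: every infinite sequence $G_0,G_1,G_2,\dots$ of $P_4$-extendible graphs contains $G_i,G_j$ with $i<j$ such that $G_i$ is isomorphic to an induced subgraph of $G_j$. Equivalently, every hereditary property $\mathcal P$ on $P_4$-extendible graphs has, up to isomorphism, only finitely many $P_4$-extendible minimal $\mathcal P$-obstructions, and a $P_4$-extendible graph has $\mathcal P$ if and only if none of these obstructions is isomorphic to an induced subgraph of it. -/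

import Mathlib

open scoped SimpleGraph

universe u

/-- A finite simple graph, bundled with its vertex type. -/
structure FiniteGraph : Type (u + 1) where
  V : Type u
  finite_V : Finite V
  graph : SimpleGraph V

namespace FiniteGraph

/-- `H.IndLE G`: `H` is (isomorphic to) an induced subgraph of `G`. -/
def IndLE (H G : FiniteGraph.{u}) : Prop := H.graph ⊴ G.graph

/-- `H` and `G` are isomorphic. -/
def IsIso (H G : FiniteGraph.{u}) : Prop := Nonempty (H.graph ≃g G.graph)

/-- The subgraph of `G` induced by a set `s` of vertices. -/
def induce (G : FiniteGraph.{u}) (s : Set G.V) : FiniteGraph.{u} where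
  V := s
  finite_V := haveI := G.finite_V; inferInstance
  graph := G.graph.induce s

end FiniteGraph

section P4Extendible

variable {V : Type u}

/-- The vertex set `W` induces a path on four vertices in `G`. -/
def InducesP4 (G : SimpleGraph V) (W : Set V) : Prop :=
  Nonempty (G.induce W ≃g SimpleGraph.pathGraph 4)

/-- The set `S(W)` of the vertices outside `W` that belong to an induced `P₄` of `G` sharing
vertices with `W`. -/
def p4Extension (G : SimpleGraph V) (W : Set V) : Set V :=
  {v | v ∉ W ∧ ∃ W' : Set V, InducesP4 G W' ∧ v ∈ W' ∧ (W' ∩ W).Nonempty}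

/-- `G` is `P₄`-extendible: for every vertex set `W` inducing a `P₄` there is at most one vertex
outside `W` which belongs to an induced `P₄` sharing vertices with `W`. -/
def IsP4Extendible (G : SimpleGraph V) : Prop :=
  ∀ W : Set V, InducesP4 G W → (p4Extension G W).Subsingleton

end P4Extendible

/-- The class of finite `P₄`-extendible graphs. -/
def p4ExtendibleGraphs : Set FiniteGraph.{u} := {G | IsP4Extendible G.graph}

/-- `P` is a hereditary property on the graph class `C`: within `C` it is inherited by induced
subgraphs (in particular it is invariant under isomorphism). -/
def IsHereditaryOn (C : Set FiniteGraph.{u}) (P : FiniteGraph.{u} → Prop) : Prop :=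
  ∀ G ∈ C, ∀ H ∈ C, H.IndLE G → P G → P H

/-- `G` is a minimal `P`-obstruction belonging to the class `C`: `G` does not have the property `P`,
but each of its proper induced subgraphs does. -/
def IsMinimalObstructionIn (C : Set FiniteGraph.{u}) (P : FiniteGraph.{u} → Prop)
    (G : FiniteGraph.{u}) : Prop :=
  G ∈ C ∧ ¬ P G ∧ ∀ s : Set G.V, s ≠ Set.univ → P (G.induce s)

/-!
# `P₄`-extendible graphs are well-quasi-ordered

The proof rests on a decomposition: every nonempty `P₄`-extendible graph is glued, according to one of
finitely many patterns, from two proper induced subgraphs `A` and `B` and a core of at most five vertices,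
each of which is joined to all or to none of the vertices of `A` and `B`
(`IsP4Extendible.exists_glue`). Gluing is monotone for the induced subgraph relation (`glue_mono`).
In a minimal bad sequence the parts `A`, `B` of its members are well-quasi-ordered, so two members with
the same pattern and comparable parts exist, which contradicts badness
(`partiallyWellOrderedOn_p4ExtendibleGraphs`).

If a graph or its complement is disconnected, it is glued from two parts without core. Otherwise, it
contains an induced `P₄` by Seinsche's theorem (`Indecomposable.exists_path4`). This `P₄` together with
its at most one extension vertex is a set `D` such that every `P₄` meeting `D` lies inside `D`. Hence
a vertex outside `D` sees all of `D`, nothing of `D`, or a fixed "middle" part of `D`, and the vertices of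
the last kind form with `D` a module `U` (`IsP4Extendible.exists_module`). If `U` contains every vertex,
then `D` is the core. If not, then collapsing `U` to a vertex `u` of `D` leaves a smaller graph, still
connected and co-connected, in which `u` lies on no `P₄`. All vertices of the core of the smaller
graph lie on a `P₄`, so `u` is not in that core, and replacing `u` by `U` again makes it a core of the
original graph (`Indecomposable.exists_core`).

The statement on obstructions follows because pairwise non-isomorphic minimal obstructions are
incomparable, so in a well-quasi-ordered class there are only finitely many.
-/

/-! ### Induced paths on four vertices and Seinsche's theorem -/

section Path4

variable {V : Type u}

/-- `a - b - c - d` is an induced path of `G`. The six conditions force the four vertices to be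
pairwise distinct, so distinctness is not part of the definition. -/
def IsPath4 (G : SimpleGraph V) (a b c d : V) : Prop :=
  G.Adj a b ∧ G.Adj b c ∧ G.Adj c d ∧ ¬ G.Adj a c ∧ ¬ G.Adj b d ∧ ¬ G.Adj a d

theorem IsPath4.ne {G : SimpleGraph V} {a b c d : V} (h : IsPath4 G a b c d) :
    a ≠ b ∧ a ≠ c ∧ a ≠ d ∧ b ≠ c ∧ b ≠ d ∧ c ≠ d := by
  obtain ⟨h1, h2, h3, h4, h5, h6⟩ := h
  refine ⟨h1.ne, ?_, ?_, h2.ne, ?_, h3.ne⟩ <;> rintro rfl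
  · exact h6 h3
  · exact h4 h3.symm
  · exact h6 h1

/-- The complement of the path `a - b - c - d` is the path `b - d - a - c`. -/
theorem IsPath4.compl {G : SimpleGraph V} {a b c d : V} (h : IsPath4 G a b c d) :
    IsPath4 Gᶜ b d a c := by
  obtain ⟨hab, hac, had, hbc, hbd, hcd⟩ := h.ne
  obtain ⟨h1, h2, h3, h4, h5, h6⟩ := h
  simp only [IsPath4, SimpleGraph.compl_adj, G.adj_comm d a, G.adj_comm b a, G.adj_comm d c]
  tauto

theorem inducesP4_iff {G : SimpleGraph V} {W : Set V} :
    InducesP4 G W ↔ ∃ a b c d, IsPath4 G a b c d ∧ W = {a, b, c, d} := by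
  constructor
  · rintro ⟨e⟩
    have key : ∀ i j : Fin 4, G.Adj (e.symm i : V) (e.symm j) ↔ (SimpleGraph.pathGraph 4).Adj i j :=
      fun i j => e.symm.map_rel_iff
    refine ⟨e.symm 0, e.symm 1, e.symm 2, e.symm 3, ?_, ?_⟩
    · simp only [IsPath4, key, SimpleGraph.pathGraph_adj]
      decide
    · ext x
      constructor
      · intro hx
        have hs : x = e.symm (e ⟨x, hx⟩) := by simp
        rw [hs]
        generalize e ⟨x, hx⟩ = i
        fin_cases i <;> simp
      · rintro (rfl | rfl | rfl | rfl) <;> exact Subtype.property _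
  · rintro ⟨a, b, c, d, h, rfl⟩
    obtain ⟨hab, hac, had, hbc, hbd, hcd⟩ := h.ne
    obtain ⟨h1, h2, h3, h4, h5, h6⟩ := h
    let f : Fin 4 → ({a, b, c, d} : Set V) :=
      ![⟨a, by simp⟩, ⟨b, by simp⟩, ⟨c, by simp⟩, ⟨d, by simp⟩]
    have hf : Function.Bijective f := by
      constructor
      · intro i j hij
        have hij' := congrArg Subtype.val hij
        fin_cases i <;> fin_cases j <;> simp_all [f]
      · rintro ⟨x, rfl | rfl | rfl | rfl⟩
        exacts [⟨0, rfl⟩, ⟨1, rfl⟩, ⟨2, rfl⟩, ⟨3, rfl⟩]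
    refine ⟨RelIso.symm ⟨Equiv.ofBijective f hf, ?_⟩⟩
    intro i j
    rw [SimpleGraph.pathGraph_adj]
    have h1' := h1.symm
    have h2' := h2.symm
    have h3' := h3.symm
    have h4' : ¬ G.Adj c a := fun e => h4 e.symm
    have h5' : ¬ G.Adj d b := fun e => h5 e.symm
    have h6' : ¬ G.Adj d a := fun e => h6 e.symm
    fin_cases i <;> fin_cases j <;>
      simp [f, h1, h2, h3, h4, h5, h6, h1', h2', h3', h4', h5', h6']

/-- `P₄`-extendibility passes to induced subgraphs. -/
theorem IsP4Extendible.of_embedding {V' : Type u} {G : SimpleGraph V} {H : SimpleGraph V'}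
    (hG : IsP4Extendible G) (f : H ↪g G) : IsP4Extendible H := by
  have himg : ∀ W, InducesP4 H W → InducesP4 G (f '' W) := by
    intro W hW
    obtain ⟨a, b, c, d, h, rfl⟩ := inducesP4_iff.1 hW
    refine inducesP4_iff.2 ⟨f a, f b, f c, f d, ?_, by simp [Set.image_insert_eq]⟩
    simpa [IsPath4] using h
  intro W hW x hx y hy
  have key : ∀ z ∈ p4Extension H W, f z ∈ p4Extension G (f '' W) := by
    rintro z ⟨hz, W', hW', hzW', t, ht, ht'⟩
    refine ⟨fun hz' => hz ((f.injective.mem_set_image).1 hz'), f '' W', himg _ hW',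
      ⟨z, hzW', rfl⟩, f t, ⟨t, ht, rfl⟩, ⟨t, ht', rfl⟩⟩
  exact f.injective (hG _ (himg W hW) (key x hx) (key y hy))

/-- `S` has at least two vertices, and both `G[S]` and its complement are connected: every cut of
`S` is crossed by an edge and by a non-edge. -/
def Indecomposable (G : SimpleGraph V) (S : Set V) : Prop :=
  S.Nontrivial ∧ ∀ X ⊆ S, X.Nonempty → (S \ X).Nonempty →
    (∃ x ∈ X, ∃ y ∈ S \ X, G.Adj x y) ∧ (∃ x ∈ X, ∃ y ∈ S \ X, ¬ G.Adj x y)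

theorem Indecomposable.compl {G : SimpleGraph V} {S : Set V} (h : Indecomposable G S) :
    Indecomposable Gᶜ S := by
  refine ⟨h.1, fun X hX hne hne' => ?_⟩
  obtain ⟨⟨x, hx, y, hy, hxy⟩, ⟨x', hx', y', hy', hxy'⟩⟩ := h.2 X hX hne hne'
  refine ⟨⟨x', hx', y', hy', ?_⟩, ⟨x, hx, y, hy, ?_⟩⟩
  · rw [SimpleGraph.compl_adj]
    exact ⟨fun e => hy'.2 (e ▸ hx'), hxy'⟩
  · rw [SimpleGraph.compl_adj]
    tauto

/-- If deleting `v` from an indecomposable set leaves a graph without edges between `X` and the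
rest, then there is an induced `P₄` through `v`: its end-edge lies on a side of the cut containing a
non-neighbour of `v`. -/
theorem Indecomposable.exists_path4_of_cut {G : SimpleGraph V} {S : Set V}
    (h : Indecomposable G S) {v : V} (hv : v ∈ S) {X : Set V} (hX : X ⊆ S \ {v})
    (hne : X.Nonempty) (hne' : ((S \ {v}) \ X).Nonempty)
    (hno : ∀ x ∈ X, ∀ y ∈ (S \ {v}) \ X, ¬ G.Adj x y) :
    ∃ a ∈ S, ∃ b ∈ S, ∃ c ∈ S, ∃ d ∈ S, IsPath4 G a b c d := by
  have aux : ∀ X Y : Set V, X ⊆ S \ {v} → Y = (S \ {v}) \ X → Y.Nonempty →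
      (∀ x ∈ X, ∀ y ∈ Y, ¬ G.Adj x y) → (∃ q ∈ X, ¬ G.Adj v q) →
      ∃ a ∈ S, ∃ b ∈ S, ∃ c ∈ S, ∃ d ∈ S, IsPath4 G a b c d := by
    rintro X Y hX rfl hY hno ⟨q₀, hq₀, hvq₀⟩
    obtain ⟨⟨q, ⟨hqX, hqv⟩, p, ⟨hpS, hp⟩, hqp⟩, -⟩ :=
      h.2 {q ∈ X | ¬ G.Adj v q} (fun q hq => (hX hq.1).1) ⟨q₀, hq₀, hvq₀⟩
        ⟨v, hv, fun hv' => (hX hv'.1).2 rfl⟩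
    obtain ⟨⟨r, hr, t, ⟨htS, ht⟩, hrt⟩, -⟩ :=
      h.2 ((S \ {v}) \ X) (fun r hr => hr.1.1) hY ⟨v, hv, fun hv' => hv'.1.2 rfl⟩
    have hpv : p ≠ v := by
      rintro rfl
      exact hqv hqp.symm
    have hpX : p ∈ X := by
      by_contra hpX
      exact hno q hqX p ⟨⟨hpS, hpv⟩, hpX⟩ hqp
    have hvp : G.Adj v p := by
      by_contra hvp
      exact hp ⟨hpX, hvp⟩
    have htv : t = v := by
      by_contra htv
      have htX : t ∈ X := by
        by_contra htX
        exact ht ⟨⟨htS, htv⟩, htX⟩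
      exact hno t htX r hr hrt.symm
    subst htv
    exact ⟨r, hr.1.1, t, hv, p, hpS, q, (hX hqX).1, hrt, hvp, hqp.symm,
      fun e => hno p hpX r hr e.symm, hqv, fun e => hno q hqX r hr e.symm⟩
  obtain ⟨-, ⟨v', hv', q, ⟨hqS, hqv⟩, hvq⟩⟩ := h.2 {v} (by simpa using hv) ⟨v, rfl⟩
    (hne.mono fun x hx => hX hx)
  rw [Set.mem_singleton_iff] at hv'
  subst hv'
  by_cases hqX : q ∈ X
  · exact aux X _ hX rfl hne' hno ⟨q, hqX, hvq⟩
  · refine aux ((S \ {v'}) \ X) X Set.sdiff_subset ?_ hne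
      (fun x hx y hy e => hno y hy x hx e.symm) ⟨q, ⟨⟨hqS, hqv⟩, hqX⟩, hvq⟩
    rw [Set.sdiff_sdiff_cancel_left hX]

/-- Seinsche's theorem: a finite graph without induced `P₄` and with at least two vertices is
disconnected or has a disconnected complement. -/
theorem Indecomposable.exists_path4 [Finite V] {G : SimpleGraph V} :
    ∀ {S : Set V}, Indecomposable G S →
      ∃ a ∈ S, ∃ b ∈ S, ∃ c ∈ S, ∃ d ∈ S, IsPath4 G a b c d := by
  intro S
  induction hn : S.ncard using Nat.strong_induction_on generalizing S with
  | _ n ih =>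
    intro h
    obtain ⟨v, hv, w, hw, hvw⟩ := h.1
    by_cases hT : Indecomposable G (S \ {v})
    · obtain ⟨a, ha, b, hb, c, hc, d, hd, hp⟩ :=
        ih _ (hn ▸ Set.ncard_sdiff_singleton_lt_of_mem hv) rfl hT
      exact ⟨a, ha.1, b, hb.1, c, hc.1, d, hd.1, hp⟩
    · rw [Indecomposable, not_and_or] at hT
      rcases hT with hT | hT
      · -- `S = {v, w}` has only one cut, crossed by a single pair.
        rw [Set.not_nontrivial_iff] at hT
        obtain ⟨⟨x, hx, y, hy, hxy⟩, ⟨x', hx', y', hy', hxy'⟩⟩ :=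
          h.2 {v} (by simpa using hv) ⟨v, rfl⟩ ⟨w, hw, hvw.symm⟩
        rw [Set.mem_singleton_iff] at hx hx'
        subst hx hx'
        exact absurd (hT hy hy' ▸ hxy) hxy'
      · push Not at hT
        obtain ⟨X, hX, hne, hne', hcut⟩ := hT
        by_cases hno : ∃ x ∈ X, ∃ y ∈ (S \ {v}) \ X, G.Adj x y
        · obtain ⟨a, ha, b, hb, c, hc, d, hd, hp⟩ :=
            h.compl.exists_path4_of_cut hv hX hne hne' fun x hx y hy e =>
              (SimpleGraph.compl_adj _ _ _ |>.1 e).2 (hcut hno x hx y hy)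
          exact ⟨b, hb, d, hd, a, ha, c, hc, by simpa using hp.compl⟩
        · push Not at hno
          exact h.exists_path4_of_cut hv hX hne hne' hno

end Path4

/-! ### The structure of indecomposable `P₄`-extendible graphs -/

section Structure

variable {V : Type u} {G : SimpleGraph V} {S D : Set V} {a b c d x y v : V}

/-- Every induced `P₄` of `G[S]` that meets `D` lies inside `D`. -/
def P4Closed (G : SimpleGraph V) (S D : Set V) : Prop :=
  ∀ ⦃a⦄, a ∈ S → ∀ ⦃b⦄, b ∈ S → ∀ ⦃c⦄, c ∈ S → ∀ ⦃d⦄, d ∈ S → IsPath4 G a b c d →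
    (a ∈ D ∨ b ∈ D ∨ c ∈ D ∨ d ∈ D) → a ∈ D ∧ b ∈ D ∧ c ∈ D ∧ d ∈ D

/-- A vertex that forms no new `P₄` with a given one sees none, all, or just the two midpoints
of it. -/
theorem P4Closed.trichotomy (hcl : P4Closed G S D) (hDS : D ⊆ S) (h : IsPath4 G a b c d)
    (ha : a ∈ D) (hb : b ∈ D) (hc : c ∈ D) (hd : d ∈ D) (hx : x ∈ S) (hxD : x ∉ D) :
    (¬ G.Adj x a ∧ ¬ G.Adj x b ∧ ¬ G.Adj x c ∧ ¬ G.Adj x d) ∨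
    (G.Adj x a ∧ G.Adj x b ∧ G.Adj x c ∧ G.Adj x d) ∨
    (¬ G.Adj x a ∧ G.Adj x b ∧ G.Adj x c ∧ ¬ G.Adj x d) := by
  have first : ∀ p q r, p ∈ D → q ∈ D → r ∈ D → ¬ IsPath4 G x p q r := fun p q r hp hq hr e =>
    hxD (hcl hx (hDS hp) (hDS hq) (hDS hr) e (Or.inr (Or.inl hp))).1
  have second : ∀ p q r, p ∈ D → q ∈ D → r ∈ D → ¬ IsPath4 G p x q r := fun p q r hp hq hr e =>
    hxD (hcl (hDS hp) hx (hDS hq) (hDS hr) e (Or.inl hp)).2.1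
  have e1 := first a b c ha hb hc
  have e2 := first d c b hd hc hb
  have e3 := first b c d hb hc hd
  have e4 := first c b a hc hb ha
  have e5 := second a c d ha hc hd
  have e6 := second d b a hd hb ha
  have e7 := second a d c ha hd hc
  have e8 := second d a b hd ha hb
  obtain ⟨h1, h2, h3, h4, h5, h6⟩ := h
  simp only [IsPath4, G.adj_comm _ x, G.adj_comm b a, G.adj_comm c a, G.adj_comm d a,
    G.adj_comm c b, G.adj_comm d b, G.adj_comm d c, h1, h2, h3, h4, h5, h6] at *
  grind

/-- In a `P₄`-extendible graph a `P₄` `W` together with its at most one extension vertex `v` is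
closed: a `P₄` meeting `W ∪ {v}` in `v` alone would extend the `P₄` through `v` and `W` by
several vertices. The last clause describes `v` by such a `P₄`, all of whose other vertices lie
in `W`. -/
theorem IsP4Extendible.exists_p4Closed (hG : IsP4Extendible G) (h : IsPath4 G a b c d)
    (ha : a ∈ S) (hb : b ∈ S) (hc : c ∈ S) (hd : d ∈ S) :
    ∃ D ⊆ S, a ∈ D ∧ b ∈ D ∧ c ∈ D ∧ d ∈ D ∧ D.Finite ∧ D.ncard ≤ 5 ∧ P4Closed G S D ∧
      ∀ v ∈ D, ∃ p ∈ D, ∃ q ∈ D, ∃ r ∈ D, ∃ s ∈ D, IsPath4 G p q r s ∧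
        v ∈ ({p, q, r, s} : Set V) ∧
        ∀ t ∈ ({p, q, r, s} : Set V), t ≠ v → t ∈ ({a, b, c, d} : Set V) := by
  set W : Set V := {a, b, c, d} with hW
  have hWS : W ⊆ S := by
    rintro _ (rfl | rfl | rfl | rfl) <;> assumption
  let E : Set V := {v | v ∉ W ∧ ∃ p ∈ S, ∃ q ∈ S, ∃ r ∈ S, ∃ s ∈ S, IsPath4 G p q r s ∧
    v ∈ ({p, q, r, s} : Set V) ∧ (({p, q, r, s} : Set V) ∩ W).Nonempty}
  have hE : E.Subsingleton := by
    refine (hG W (inducesP4_iff.2 ⟨a, b, c, d, h, rfl⟩)).anti ?_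
    rintro v ⟨hv, p, -, q, -, r, -, s, -, hp, hv', hne⟩
    exact ⟨hv, _, inducesP4_iff.2 ⟨p, q, r, s, hp, rfl⟩, hv', hne⟩
  have hES : E ⊆ S := by
    rintro v ⟨-, p, hp, q, hq, r, hr, s, hs, -, rfl | rfl | rfl | rfl, -⟩ <;> assumption
  have hmeet : ∀ p ∈ S, ∀ q ∈ S, ∀ r ∈ S, ∀ s ∈ S, IsPath4 G p q r s →
      (({p, q, r, s} : Set V) ∩ W).Nonempty → ({p, q, r, s} : Set V) ⊆ W ∪ E := by
    intro p hp q hq r hr s hs hpath hne t ht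
    by_cases htW : t ∈ W
    · exact Or.inl htW
    · exact Or.inr ⟨htW, p, hp, q, hq, r, hr, s, hs, hpath, ht, hne⟩
  have hWcard : W.ncard ≤ 4 := by
    refine (Set.ncard_insert_le _ _).trans (Nat.succ_le_succ ?_)
    refine (Set.ncard_insert_le _ _).trans (Nat.succ_le_succ ?_)
    exact (Set.ncard_insert_le _ _).trans (Nat.succ_le_succ (Set.ncard_singleton _).le)
  have hcl : P4Closed G S (W ∪ E) := by
    intro p hp q hq r hr s hs hpath hmem
    suffices hsub : ({p, q, r, s} : Set V) ⊆ W ∪ E from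
      ⟨hsub (by simp), hsub (by simp), hsub (by simp), hsub (by simp)⟩
    by_cases hne : (({p, q, r, s} : Set V) ∩ W).Nonempty
    · exact hmeet p hp q hq r hr s hs hpath hne
    exfalso
    rw [Set.not_nonempty_iff_eq_empty, Set.eq_empty_iff_forall_notMem] at hne
    obtain ⟨v, hv, hvE⟩ : ∃ v ∈ ({p, q, r, s} : Set V), v ∈ E := by
      rcases hmem with hm | hm | hm | hm
      · exact ⟨p, by simp, hm.resolve_left fun hm => hne p ⟨by simp, hm⟩⟩
      · exact ⟨q, by simp, hm.resolve_left fun hm => hne q ⟨by simp, hm⟩⟩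
      · exact ⟨r, by simp, hm.resolve_left fun hm => hne r ⟨by simp, hm⟩⟩
      · exact ⟨s, by simp, hm.resolve_left fun hm => hne s ⟨by simp, hm⟩⟩
    obtain ⟨hvW, p', hp', q', hq', r', hr', s', hs', hpath', hv', hne'⟩ := id hvE
    have hsub := hmeet p' hp' q' hq' r' hr' s' hs' hpath' hne'
    have hout : ∀ t ∈ ({p, q, r, s} : Set V), t ≠ v →
        t ∈ p4Extension G ({p', q', r', s'} : Set V) := by
      refine fun t ht htv => ⟨fun ht' => ?_, _, inducesP4_iff.2 ⟨p, q, r, s, hpath, rfl⟩, ht,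
        v, hv, hv'⟩
      exact (hsub ht').elim (fun hW => hne t ⟨ht, hW⟩) fun ht => htv (hE ht hvE)
    have hss := hG _ (inducesP4_iff.2 ⟨p', q', r', s', hpath', rfl⟩)
    obtain ⟨n1, n2, n3, n4, n5, n6⟩ := hpath.ne
    rcases hv with rfl | rfl | rfl | rfl
    · exact n4 (hss (hout q (by simp) n1.symm) (hout r (by simp) n2.symm))
    · exact n2 (hss (hout p (by simp) n1) (hout r (by simp) n4.symm))
    · exact n1 (hss (hout p (by simp) n2) (hout q (by simp) n4))
    · exact n1 (hss (hout p (by simp) n3) (hout q (by simp) n5))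
  refine ⟨W ∪ E, Set.union_subset hWS hES, Or.inl (by simp [hW]), Or.inl (by simp [hW]),
    Or.inl (by simp [hW]), Or.inl (by simp [hW]), (Set.toFinite W).union hE.finite,
    ?_, hcl, ?_⟩
  · have := hE.finite.to_subtype
    have := Set.ncard_le_one_iff_subsingleton.2 hE
    have := Set.ncard_union_le W E
    omega
  · rintro v (hv | hv)
    · exact ⟨a, Or.inl (by simp [hW]), b, Or.inl (by simp [hW]), c, Or.inl (by simp [hW]), d,
        Or.inl (by simp [hW]), h, hv, fun t ht _ => ht⟩
    · obtain ⟨hvW, p, hp, q, hq, r, hr, s, hs, hpath, hv', hne⟩ := id hv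
      have hsub := hmeet p hp q hq r hr s hs hpath hne
      exact ⟨p, hsub (by simp), q, hsub (by simp), r, hsub (by simp), s, hsub (by simp), hpath,
        hv', fun t ht htv => (hsub ht).resolve_right fun ht' => htv (hE ht' hv)⟩

/-- `U` is a module of `G[S]`: a vertex of `S` outside `U` is adjacent to all vertices of `U` or to
none of them. -/
def IsModuleIn (G : SimpleGraph V) (S U : Set V) : Prop :=
  ∀ z ∈ S \ U, ∀ x ∈ U, ∀ y ∈ U, G.Adj z x ↔ G.Adj z y

/-- The possible neighbourhoods of `x` in a `P₄` pairwise differ in an even number of vertices, so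
the adjacency of `x` to one of the four vertices is determined by the other three. -/
theorem P4Closed.adj_iff_adj (hcl : P4Closed G S D) (hDS : D ⊆ S) (h : IsPath4 G a b c d)
    (ha : a ∈ D) (hb : b ∈ D) (hc : c ∈ D) (hd : d ∈ D) (hx : x ∈ S \ D) (hy : y ∈ S \ D)
    (hv : v ∈ ({a, b, c, d} : Set V))
    (hxy : ∀ t ∈ ({a, b, c, d} : Set V), t ≠ v → (G.Adj x t ↔ G.Adj y t)) :
    G.Adj x v ↔ G.Adj y v := by
  obtain ⟨n1, n2, n3, n4, n5, n6⟩ := h.ne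
  have tx := hcl.trichotomy hDS h ha hb hc hd hx.1 hx.2
  have ty := hcl.trichotomy hDS h ha hb hc hd hy.1 hy.2
  clear hcl h hx hy
  rcases hv with rfl | rfl | rfl | rfl
  · have k1 := hxy b (by simp) n1.symm
    have k2 := hxy c (by simp) n2.symm
    have k3 := hxy d (by simp) n3.symm
    clear hxy
    grind
  · have k1 := hxy a (by simp) n1
    have k2 := hxy c (by simp) n4.symm
    have k3 := hxy d (by simp) n5.symm
    clear hxy
    grind
  · have k1 := hxy a (by simp) n2
    have k2 := hxy b (by simp) n4
    have k3 := hxy d (by simp) n6.symm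
    clear hxy
    grind
  · have k1 := hxy a (by simp) n3
    have k2 := hxy b (by simp) n5
    have k3 := hxy c (by simp) n6
    clear hxy
    grind

/-- A vertex with the same adjacency to all but one vertex of a `P₄` has it to the last one, too. -/
theorem P4Closed.adj_iff_of_uniform (hcl : P4Closed G S D) (hDS : D ⊆ S) (h : IsPath4 G a b c d)
    (ha : a ∈ D) (hb : b ∈ D) (hc : c ∈ D) (hd : d ∈ D) (hx : x ∈ S \ D)
    (hv : v ∈ ({a, b, c, d} : Set V)) {q : Prop}
    (hxq : ∀ t ∈ ({a, b, c, d} : Set V), t ≠ v → (G.Adj x t ↔ q)) :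
    G.Adj x v ↔ q := by
  obtain ⟨n1, n2, n3, n4, n5, n6⟩ := h.ne
  have tx := hcl.trichotomy hDS h ha hb hc hd hx.1 hx.2
  clear hcl h hx
  rcases hv with rfl | rfl | rfl | rfl
  · have k1 := hxq b (by simp) n1.symm
    have k2 := hxq c (by simp) n2.symm
    have k3 := hxq d (by simp) n3.symm
    clear hxq
    grind
  · have k1 := hxq a (by simp) n1
    have k2 := hxq c (by simp) n4.symm
    have k3 := hxq d (by simp) n5.symm
    clear hxq
    grind
  · have k1 := hxq a (by simp) n2
    have k2 := hxq b (by simp) n4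
    have k3 := hxq d (by simp) n6.symm
    clear hxq
    grind
  · have k1 := hxq a (by simp) n3
    have k2 := hxq b (by simp) n5
    have k3 := hxq c (by simp) n6
    clear hxq
    grind

/-- Around a `P₄` of a `P₄`-extendible graph there are a closed set `D` with at most five vertices
and the module `U` of `G[S]` formed by `D` and the vertices that distinguish vertices of `D`.
All vertices of `U \ D` have the same neighbours in `D`. -/
theorem IsP4Extendible.exists_module (hG : IsP4Extendible G) (h : IsPath4 G a b c d)
    (ha : a ∈ S) (hb : b ∈ S) (hc : c ∈ S) (hd : d ∈ S) :
    ∃ D U, D ⊆ U ∧ U ⊆ S ∧ a ∈ D ∧ b ∈ D ∧ D.Finite ∧ D.ncard ≤ 5 ∧ P4Closed G S D ∧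
      (∀ v ∈ D, ∃ p ∈ D, ∃ q ∈ D, ∃ r ∈ D, ∃ s ∈ D, IsPath4 G p q r s ∧
        v ∈ ({p, q, r, s} : Set V)) ∧
      (∀ v ∈ D, ∀ x ∈ U \ D, ∀ y ∈ U \ D, G.Adj v x ↔ G.Adj v y) ∧ IsModuleIn G S U := by
  obtain ⟨D, hDS, haD, hbD, hcD, hdD, hfin, hcard, hcl, hgen⟩ := hG.exists_p4Closed h ha hb hc hd
  have agree : ∀ x ∈ S \ D, ∀ y ∈ S \ D, (∀ t ∈ ({a, b, c, d} : Set V), G.Adj x t ↔ G.Adj y t) →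
      ∀ v ∈ D, G.Adj x v ↔ G.Adj y v := by
    intro x hx y hy hxy v hv
    obtain ⟨p, hp, q, hq, r, hr, s, hs, hpath, hvm, hoth⟩ := hgen v hv
    exact hcl.adj_iff_adj hDS hpath hp hq hr hs hx hy hvm fun t ht htv => hxy t (hoth t ht htv)
  have uniform : ∀ x ∈ S \ D, (G.Adj x a ↔ G.Adj x b) → ∀ v ∈ D, G.Adj x v ↔ G.Adj x a := by
    intro x hx hxab v hv
    obtain ⟨p, hp, q, hq, r, hr, s, hs, hpath, hvm, hoth⟩ := hgen v hv
    have tW := hcl.trichotomy hDS h haD hbD hcD hdD hx.1 hx.2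
    refine hcl.adj_iff_of_uniform hDS hpath hp hq hr hs hx hvm fun t ht htv => ?_
    rcases hoth t ht htv with rfl | rfl | rfl | rfl <;> grind only
  refine ⟨D, D ∪ {x | x ∈ S \ D ∧ ¬ (G.Adj x a ↔ G.Adj x b)}, Set.subset_union_left,
    Set.union_subset hDS fun x hx => hx.1.1, haD, hbD, hfin, hcard, hcl, ?_, ?_, ?_⟩
  · intro v hv
    obtain ⟨p, hp, q, hq, r, hr, s, hs, hpath, hvm, -⟩ := hgen v hv
    exact ⟨p, hp, q, hq, r, hr, s, hs, hpath, hvm⟩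
  · rintro v hv x ⟨hxU, hxD⟩ y ⟨hyU, hyD⟩
    obtain ⟨hx, hx'⟩ := hxU.resolve_left hxD
    obtain ⟨hy, hy'⟩ := hyU.resolve_left hyD
    rw [G.adj_comm v x, G.adj_comm v y]
    refine agree x hx y hy ?_ v hv
    have tx := hcl.trichotomy hDS h haD hbD hcD hdD hx.1 hx.2
    have ty := hcl.trichotomy hDS h haD hbD hcD hdD hy.1 hy.2
    rintro t (rfl | rfl | rfl | rfl) <;> grind only
  · have toA : ∀ z ∈ S \ (D ∪ {x | x ∈ S \ D ∧ ¬ (G.Adj x a ↔ G.Adj x b)}),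
        ∀ x ∈ D ∪ {x | x ∈ S \ D ∧ ¬ (G.Adj x a ↔ G.Adj x b)}, G.Adj z x ↔ G.Adj z a := by
      rintro z ⟨hzS, hzU⟩ x hx
      have hzD : z ∉ D := fun hz => hzU (Or.inl hz)
      have hzab : G.Adj z a ↔ G.Adj z b := by
        by_contra hne
        exact hzU (Or.inr ⟨⟨hzS, hzD⟩, hne⟩)
      have tz := hcl.trichotomy hDS h haD hbD hcD hdD hzS hzD
      rcases hx with hx | ⟨hx, hxab⟩
      · exact uniform z ⟨hzS, hzD⟩ hzab x hx
      · have tx := hcl.trichotomy hDS h haD hbD hcD hdD hx.1 hx.2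
        have hab := h.1
        have hbd := h.2.2.2.2.1
        constructor
        · -- An edge from a vertex `z` without neighbours in `D` to `x` gives the path `z-x-b-a`.
          intro hzx
          by_contra hza
          refine hzD (hcl hzS hx.1 hb ha ⟨hzx, ?_, hab.symm, ?_, ?_, hza⟩
            (Or.inr (Or.inr (Or.inl hbD)))).1
          all_goals grind only [SimpleGraph.adj_comm]
        · -- A non-edge from a vertex `z` that sees all of `D` to `x` gives the path `d-z-b-x`.
          intro hza
          by_contra hzx
          refine hzD (hcl hd hzS hb hx.1 ⟨?_, ?_, ?_, ?_, hzx, ?_⟩ (Or.inl hdD)).2.1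
          all_goals grind only [SimpleGraph.adj_comm]
    intro z hz x hx y hy
    rw [toA z hz x hx, toA z hz y hy]

/-- An indecomposable set `S` of a `P₄`-extendible graph contains a set of at most five
vertices, each with the same adjacency to all the remaining vertices of `S`. If the module `U` around
some `P₄` is not all of `S`, it is collapsed to one of its vertices `u`; `u` lies on no `P₄` of
the smaller set, so it is not in the set found there. -/
theorem Indecomposable.exists_core [Finite V] (hG : IsP4Extendible G) :
    ∀ {S : Set V}, Indecomposable G S → ∃ D ⊆ S, D.Nonempty ∧ D.ncard ≤ 5 ∧
      (∀ v ∈ D, ∃ p ∈ S, ∃ q ∈ S, ∃ r ∈ S, ∃ s ∈ S, IsPath4 G p q r s ∧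
        v ∈ ({p, q, r, s} : Set V)) ∧
      ∀ v ∈ D, ∀ x ∈ S \ D, ∀ y ∈ S \ D, G.Adj v x ↔ G.Adj v y := by
  intro S
  induction hn : S.ncard using Nat.strong_induction_on generalizing S with
  | _ n ih =>
    intro hS
    obtain ⟨u, hu, b, hb, c, hc, d, hd, h⟩ := hS.exists_path4
    obtain ⟨D, U, hDU, hUS, huD, hbD, hfin, hcard, hcl, hgen, hhom, hmod⟩ :=
      hG.exists_module h hu hb hc hd
    have hDS := hDU.trans hUS
    by_cases hSU : S ⊆ U
    · obtain rfl := hUS.antisymm hSU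
      refine ⟨D, hDU, ⟨u, huD⟩, hcard, fun v hv => ?_, hhom⟩
      obtain ⟨p, hp, q, hq, r, hr, s, hs, hpath, hvm⟩ := hgen v hv
      exact ⟨p, hDS hp, q, hDS hq, r, hDS hr, s, hDS hs, hpath, hvm⟩
    obtain ⟨z, hzS, hzU⟩ := Set.not_subset.1 hSU
    have huU := hDU huD
    set T : Set V := insert u (S \ U) with hT
    have hTS : T ⊆ S := Set.insert_subset hu Set.sdiff_subset
    have hbT : b ∉ T := by
      rintro (rfl | hbT)
      · exact h.1.ne rfl
      · exact hbT.2 (hDU hbD)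
    have hTU : ∀ x ∈ T, x ∈ U → x = u := fun x hx hxU =>
      hx.elim id fun hx => absurd hxU hx.2
    have hlt : T.ncard < n := by
      rw [← hn]
      exact Set.ncard_lt_ncard ⟨hTS, fun hST => hbT (hST hb)⟩
    -- A cut of `T` extends to a cut of `S` by adding `U` to the side of `u`.
    have hcut : ∀ X ⊆ T, u ∉ X → X.Nonempty →
        (∃ x ∈ X, ∃ y ∈ T \ X, G.Adj x y) ∧ (∃ x ∈ X, ∃ y ∈ T \ X, ¬ G.Adj x y) := by
      intro X hXT huX hne
      have hXU : ∀ x ∈ X, x ∈ S \ U := fun x hx =>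
        (hXT hx).resolve_left fun e => huX (e ▸ hx)
      have move : ∀ x ∈ X, ∀ y ∈ S \ X, ∃ y' ∈ T \ X, G.Adj x y ↔ G.Adj x y' := by
        intro x hx y hy
        by_cases hyU : y ∈ U
        · exact ⟨u, ⟨Or.inl rfl, huX⟩, hmod x (hXU x hx) y hyU u huU⟩
        · exact ⟨y, ⟨Or.inr ⟨hy.1, hyU⟩, hy.2⟩, Iff.rfl⟩
      obtain ⟨⟨x, hx, y, hy, hxy⟩, ⟨x', hx', y', hy', hxy'⟩⟩ :=
        hS.2 X (hXT.trans hTS) hne ⟨u, hu, huX⟩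
      obtain ⟨t, ht, hiff⟩ := move x hx y hy
      obtain ⟨t', ht', hiff'⟩ := move x' hx' y' hy'
      exact ⟨⟨x, hx, t, ht, hiff.1 hxy⟩, ⟨x', hx', t', ht', fun e => hxy' (hiff'.2 e)⟩⟩
    have hTind : Indecomposable G T := by
      refine ⟨⟨u, Or.inl rfl, z, Or.inr ⟨hzS, hzU⟩, fun e => hzU (e ▸ huU)⟩, ?_⟩
      intro X hXT hne hne'
      by_cases huX : u ∈ X
      · obtain ⟨⟨x, hx, y, hy, hxy⟩, ⟨x', hx', y', hy', hxy'⟩⟩ :=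
          hcut (T \ X) Set.sdiff_subset (fun hu' => hu'.2 huX) hne'
        rw [Set.sdiff_sdiff_cancel_left hXT] at hy hy'
        exact ⟨⟨y, hy, x, hx, hxy.symm⟩, ⟨y', hy', x', hx', fun e => hxy' e.symm⟩⟩
      · exact hcut X hXT huX hne
    obtain ⟨D', hD'T, hne, hcard', hgen', hhom'⟩ := ih _ hlt rfl hTind
    have huD' : u ∉ D' := by
      intro huD'
      obtain ⟨p, hp, q, hq, r, hr, s, hs, hpath, hvm⟩ := hgen' u huD'
      have hmem : p ∈ D ∨ q ∈ D ∨ r ∈ D ∨ s ∈ D := by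
        rcases hvm with rfl | rfl | rfl | rfl <;> tauto
      obtain ⟨h1, h2, -, -⟩ := hcl (hTS hp) (hTS hq) (hTS hr) (hTS hs) hpath hmem
      exact hpath.1.ne ((hTU p hp (hDU h1)).trans (hTU q hq (hDU h2)).symm)
    have hout : ∀ v ∈ D', v ∈ S \ U := fun v hv =>
      (hD'T hv).resolve_left fun e => huD' (e ▸ hv)
    refine ⟨D', hD'T.trans hTS, hne, hcard', fun v hv => ?_, ?_⟩
    · obtain ⟨p, hp, q, hq, r, hr, s, hs, hpath, hvm⟩ := hgen' v hv
      exact ⟨p, hTS hp, q, hTS hq, r, hTS hr, s, hTS hs, hpath, hvm⟩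
    · have toU : ∀ v ∈ D', ∀ x ∈ S \ D', G.Adj v x ↔ G.Adj v u := by
        intro v hv x hx
        by_cases hxU : x ∈ U
        · exact hmod v (hout v hv) x hxU u huU
        · exact hhom' v hv x ⟨Or.inr ⟨hx.1, hxU⟩, hx.2⟩ u ⟨Or.inl rfl, huD'⟩
      intro v hv x hx y hy
      rw [toU v hv x hx, toU v hv y hy]

end Structure

/-! ### Gluing graphs along a small core -/

section Gluing

variable {V α β α' β' : Type u}

/-- The data for gluing two graphs `A` and `B` along a core with at most five vertices: the number of
vertices of the core, the graph on the core, the set of the core vertices that are joined to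
all vertices of `A` and `B` (the other core vertices being joined to none), and whether all or none of
the pairs between `A` and `B` are edges. -/
abbrev GlueCode : Type := Σ k : Fin 6, SimpleGraph (Fin k) × Set (Fin k) × Prop

/-- The graph glued from `A` and `B` according to `c`. -/
def glue (c : GlueCode) (A : SimpleGraph α) (B : SimpleGraph β) :
    SimpleGraph (Fin c.1 ⊕ (α ⊕ β)) where
  Adj
    | .inl i, .inl j => c.2.1.Adj i j
    | .inl i, .inr _ => i ∈ c.2.2.1
    | .inr _, .inl j => j ∈ c.2.2.1
    | .inr (.inl x), .inr (.inl y) => A.Adj x y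
    | .inr (.inr x), .inr (.inr y) => B.Adj x y
    | .inr (.inl _), .inr (.inr _) => c.2.2.2
    | .inr (.inr _), .inr (.inl _) => c.2.2.2
  symm := ⟨by rintro (i | x | x) (j | y | y) h <;> first | exact h | exact SimpleGraph.adj_symm _ h⟩
  loopless := ⟨by rintro (i | x | x) h <;> exact SimpleGraph.irrefl _ h⟩

theorem glue_mono (c : GlueCode) {A : SimpleGraph α} {B : SimpleGraph β} {A' : SimpleGraph α'}
    {B' : SimpleGraph β'} (hA : A ⊴ A') (hB : B ⊴ B') : glue c A B ⊴ glue c A' B' := by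
  obtain ⟨f⟩ := hA
  obtain ⟨g⟩ := hB
  refine ⟨⟨⟨Sum.map id (Sum.map f g),
    Function.injective_id.sumMap (f.injective.sumMap g.injective)⟩, ?_⟩⟩
  rintro (i | x | x) (j | y | y) <;>
    simp [glue]

theorem exists_glue_iso [Finite V] {G : SimpleGraph V} {D X : Set V} (hDX : Disjoint D X)
    (hcard : D.ncard ≤ 5) (hD : ∀ v ∈ D, ∀ x ∉ D, ∀ y ∉ D, G.Adj v x → G.Adj v y) {J : Prop}
    (hX : ∀ x ∈ X, ∀ y ∈ (D ∪ X)ᶜ, G.Adj x y ↔ J) :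
    ∃ c, Nonempty (glue c (G.induce X) (G.induce (D ∪ X)ᶜ) ≃g G) := by
  have e : Fin D.ncard ≃ D := (Finite.equivFin D).symm
  let H : Set V := {v | ∃ x ∉ D, G.Adj v x}
  have hH : ∀ v ∈ D, ∀ x ∉ D, G.Adj v x ↔ v ∈ H := fun v hv x hx =>
    ⟨fun h => ⟨x, hx, h⟩, fun ⟨y, hy, h⟩ => hD v hv y hy x hx h⟩
  let c : GlueCode := ⟨⟨D.ncard, by omega⟩, G.comap fun i => (e i : V), {i | (e i : V) ∈ H}, J⟩
  let f : Fin D.ncard ⊕ (X ⊕ ((D ∪ X)ᶜ : Set V)) → V :=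
    Sum.elim (fun i => e i) (Sum.elim Subtype.val Subtype.val)
  have hXD : ∀ x : X, (x : V) ∉ D := fun x hx => hDX.le_bot ⟨hx, x.2⟩
  have hYD : ∀ y : ((D ∪ X)ᶜ : Set V), (y : V) ∉ D := fun y hy => y.2 (Or.inl hy)
  have hYX : ∀ y : ((D ∪ X)ᶜ : Set V), (y : V) ∉ X := fun y hy => y.2 (Or.inr hy)
  have hf : Function.Bijective f := by
    constructor
    · refine (Subtype.val_injective.comp e.injective).sumElim
        (Subtype.val_injective.sumElim Subtype.val_injective fun x y h => hYX y (h ▸ x.2)) ?_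
      rintro i (x | y) h
      · exact hXD x ((show (e i : V) = x from h) ▸ (e i).2)
      · exact hYD y ((show (e i : V) = y from h) ▸ (e i).2)
    · intro v
      by_cases hvD : v ∈ D
      · exact ⟨.inl (e.symm ⟨v, hvD⟩), by simp [f]⟩
      by_cases hvX : v ∈ X
      · exact ⟨.inr (.inl ⟨v, hvX⟩), rfl⟩
      · exact ⟨.inr (.inr ⟨v, fun h => h.elim hvD hvX⟩), rfl⟩
  refine ⟨c, ⟨⟨Equiv.ofBijective f hf, ?_⟩⟩⟩
  rintro (i | x | x) (j | y | y)
  · exact Iff.rfl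
  · exact hH _ (e i).2 _ (hXD y)
  · exact hH _ (e i).2 _ (hYD y)
  · exact (G.adj_comm _ _).trans (hH _ (e j).2 _ (hXD x))
  · exact Iff.rfl
  · exact hX x x.2 y y.2
  · exact (G.adj_comm _ _).trans (hH _ (e j).2 _ (hYD x))
  · exact (G.adj_comm _ _).trans (hX y y.2 x x.2)
  · exact Iff.rfl

/-- A nonempty `P₄`-extendible graph is glued from two proper induced subgraphs: with empty core if
it or its complement is disconnected, and otherwise with one of the two parts empty. -/
theorem IsP4Extendible.exists_glue [Finite V] [Nonempty V] {G : SimpleGraph V}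
    (hG : IsP4Extendible G) : ∃ X Y : Set V, X ≠ Set.univ ∧ Y ≠ Set.univ ∧
      ∃ c, Nonempty (glue c (G.induce X) (G.induce Y) ≃g G) := by
  have core : ∀ D : Set V, D.Nonempty → D.ncard ≤ 5 →
      (∀ v ∈ D, ∀ x ∉ D, ∀ y ∉ D, G.Adj v x → G.Adj v y) → ∃ X Y : Set V, X ≠ Set.univ ∧
      Y ≠ Set.univ ∧ ∃ c, Nonempty (glue c (G.induce X) (G.induce Y) ≃g G) := by
    rintro D ⟨v, hv⟩ hcard hD
    refine ⟨Dᶜ, (D ∪ Dᶜ)ᶜ, fun h => (h ▸ Set.mem_univ v : v ∈ Dᶜ) hv,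
      fun h => (h ▸ Set.mem_univ v : v ∈ (D ∪ Dᶜ)ᶜ) (Or.inl hv),
      exists_glue_iso (J := True) disjoint_compl_right hcard hD ?_⟩
    simp
  have cut : ∀ (X : Set V) (J : Prop), X.Nonempty → Xᶜ.Nonempty →
      (∀ x ∈ X, ∀ y ∉ X, G.Adj x y ↔ J) → ∃ X Y : Set V, X ≠ Set.univ ∧
      Y ≠ Set.univ ∧ ∃ c, Nonempty (glue c (G.induce X) (G.induce Y) ≃g G) := by
    rintro X J ⟨x, hx⟩ ⟨y, hy⟩ hX
    refine ⟨X, (∅ ∪ X)ᶜ, fun h => hy (h ▸ Set.mem_univ y),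
      fun h => (h ▸ Set.mem_univ x : x ∈ (∅ ∪ X)ᶜ) (Or.inr hx),
      exists_glue_iso (J := J) (Set.empty_disjoint X) (by simp) (by simp) ?_⟩
    simpa using hX
  by_cases h : Indecomposable G Set.univ
  · obtain ⟨D, -, hne, hcard, -, hhom⟩ := h.exists_core hG
    exact core D hne hcard fun v hv x hx y hy =>
      (hhom v hv x ⟨trivial, hx⟩ y ⟨trivial, hy⟩).1
  rw [Indecomposable, not_and_or] at h
  rcases h with h | h
  · have : Subsingleton V := by
      rwa [Set.nontrivial_univ_iff, not_nontrivial_iff_subsingleton] at h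
    obtain ⟨v⟩ := ‹Nonempty V›
    refine core {v} ⟨v, rfl⟩ (by simp) fun _ _ x hx => absurd (Subsingleton.elim x v) hx
  · push Not at h
    obtain ⟨X, -, hne, hne', h⟩ := h
    rw [← Set.compl_eq_univ_sdiff] at hne' h
    by_cases hno : ∃ x ∈ X, ∃ y ∈ Xᶜ, G.Adj x y
    · exact cut X True hne hne' fun x hx y hy => iff_true_intro (h hno x hx y hy)
    · push Not at hno
      exact cut X False hne hne' fun x hx y hy => iff_false_intro (hno x hx y hy)

end Gluing

/-! ### Well-quasi-ordering -/

section WellQuasiOrder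

open Set.PartiallyWellOrderedOn

theorem FiniteGraph.IndLE.refl (G : FiniteGraph.{u}) : G.IndLE G :=
  SimpleGraph.IsIndContained.refl _

theorem FiniteGraph.IndLE.trans {G H K : FiniteGraph.{u}} (h : G.IndLE H) (h' : H.IndLE K) :
    G.IndLE K :=
  SimpleGraph.IsIndContained.trans h h'

instance : IsPreorder FiniteGraph.{u} FiniteGraph.IndLE where
  refl := FiniteGraph.IndLE.refl
  trans _ _ _ := FiniteGraph.IndLE.trans

theorem FiniteGraph.induce_indLE (G : FiniteGraph.{u}) (s : Set G.V) : (G.induce s).IndLE G :=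
  ⟨SimpleGraph.Embedding.induce s⟩

theorem mem_p4ExtendibleGraphs_of_indLE {G H : FiniteGraph.{u}} (hG : G ∈ p4ExtendibleGraphs)
    (h : H.IndLE G) : H ∈ p4ExtendibleGraphs :=
  h.elim fun f => IsP4Extendible.of_embedding hG f

theorem FiniteGraph.card_induce_lt (G : FiniteGraph.{u}) {s : Set G.V} (hs : s ≠ Set.univ) :
    Nat.card (G.induce s).V < Nat.card G.V := by
  have := G.finite_V
  have h := Set.ncard_lt_ncard (Set.ssubset_univ_iff.2 hs)
  rwa [Set.ncard_univ] at h

/-- In a minimal bad sequence `f`, the graphs that are smaller than and contained in a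
term of `f` are well-quasi-ordered: a bad sequence `g` of such graphs could be spliced
into `f` at the term containing the first graph of `g`. -/
theorem partiallyWellOrderedOn_below_minBadSeq {α : Type*} {r : α → α → Prop} [IsTrans α r]
    {rk : α → ℕ} {s t : Set α} {f : ℕ → α} (hf : IsBadSeq r s f)
    (hmin : ∀ n, IsMinBadSeq r rk s n f) (hts : t ⊆ s)
    (ht : ∀ x ∈ t, ∃ n, r x (f n) ∧ rk x < rk (f n)) : t.PartiallyWellOrderedOn r := by
  rw [iff_forall_not_isBadSeq]
  rintro g ⟨hgt, hg⟩
  choose k hk hk' using fun n => ht (g n) (hgt n)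
  -- Start at the term of `g` whose index in `f` is least.
  obtain ⟨m, hm⟩ : ∃ m, ∀ n, k m ≤ k n := by
    obtain ⟨_, ⟨m, rfl⟩, hm⟩ := wellFounded_lt.has_min (Set.range k) ⟨_, 0, rfl⟩
    exact ⟨m, fun n => not_lt.1 (hm _ ⟨n, rfl⟩)⟩
  refine hmin (k m) (fun i => if i < k m then f i else g (m + (i - k m)))
    (fun i hi => (if_pos hi).symm) (by simpa using hk' m) ⟨fun i => ?_, fun i j hij => ?_⟩
  · dsimp only
    split_ifs
    exacts [hf.1 i, hts (hgt _)]
  · dsimp only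
    split_ifs with hi hj hj
    · exact hf.2 i j hij
    · exact fun h => hf.2 i _ (hi.trans_le (hm _)) (_root_.trans h (hk _))
    · omega
    · exact hg _ _ (by omega)

theorem partiallyWellOrderedOn_p4ExtendibleGraphs :
    (p4ExtendibleGraphs.{u}).PartiallyWellOrderedOn FiniteGraph.IndLE := by
  by_contra hbad
  rw [iff_not_exists_isMinBadSeq fun G : FiniteGraph.{u} => Nat.card G.V, not_not] at hbad
  obtain ⟨f, hf, hmin⟩ := hbad
  have hne : ∀ n, Nonempty (f n).V := by
    intro n
    by_contra h
    rw [not_nonempty_iff] at h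
    exact hf.2 n (n + 1) n.lt_succ_self SimpleGraph.IsIndContained.of_isEmpty
  have hdec := fun n => by
    have := (f n).finite_V
    exact IsP4Extendible.exists_glue (hf.1 n)
  choose X Y hX hY c hiso using hdec
  let t : Set FiniteGraph.{u} := {K | ∃ n, ∃ s : Set (f n).V, s ≠ Set.univ ∧ K = (f n).induce s}
  have ht : t.PartiallyWellOrderedOn FiniteGraph.IndLE := by
    refine partiallyWellOrderedOn_below_minBadSeq hf hmin ?_ ?_
    · rintro _ ⟨n, s, -, rfl⟩
      exact mem_p4ExtendibleGraphs_of_indLE (hf.1 n) ((f n).induce_indLE s)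
    · rintro _ ⟨n, s, hs, rfl⟩
      exact ⟨n, (f n).induce_indLE s, (f n).card_induce_lt hs⟩
  obtain ⟨φ, hφ⟩ := ht.exists_monotone_subseq (f := fun n => (f n).induce (X n))
    fun n => ⟨n, X n, hX n, rfl⟩
  obtain ⟨ψ, hψ⟩ := ht.exists_monotone_subseq (f := fun n => (f (φ n)).induce (Y (φ n)))
    fun n => ⟨φ n, Y (φ n), hY _, rfl⟩
  obtain ⟨i, j, hij, hc⟩ : ∃ i j, i < j ∧ c (φ (ψ i)) = c (φ (ψ j)) := by
    obtain ⟨i, j, hij, hc⟩ := Finite.exists_ne_map_eq_of_infinite fun n => c (φ (ψ n))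
    rcases hij.lt_or_gt with h | h
    exacts [⟨i, j, h, hc⟩, ⟨j, i, h, hc.symm⟩]
  refine hf.2 (φ (ψ i)) (φ (ψ j)) (φ.strictMono (ψ.strictMono hij)) ?_
  obtain ⟨e⟩ := hiso (φ (ψ i))
  obtain ⟨e'⟩ := hiso (φ (ψ j))
  rw [hc] at e
  have hglue := glue_mono (c (φ (ψ j))) (hφ _ _ (ψ.monotone hij.le)) (hψ _ _ hij.le)
  exact SimpleGraph.IsIndContained.trans ⟨e.symm.toEmbedding⟩
    (hglue.trans ⟨e'.toEmbedding⟩)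

end WellQuasiOrder

/-! ### Minimal obstructions of hereditary properties -/

section Obstructions

theorem FiniteGraph.IsIso.indLE {G H : FiniteGraph.{u}} (h : G.IsIso H) : G.IndLE H :=
  h.elim fun e => ⟨e.toEmbedding⟩

/-- Isomorphism as an equivalence relation. -/
def FiniteGraph.isoSetoid : Setoid FiniteGraph.{u} where
  r := FiniteGraph.IsIso
  iseqv := ⟨fun _ => ⟨RelIso.refl _⟩, fun ⟨e⟩ => ⟨e.symm⟩, fun ⟨e⟩ ⟨e'⟩ => ⟨e.trans e'⟩⟩

/-- A graph contained in `G` is isomorphic to `G` or to a proper induced subgraph. -/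
theorem FiniteGraph.IndLE.isIso_or {G H : FiniteGraph.{u}} (h : H.IndLE G) :
    H.IsIso G ∨ ∃ s : Set G.V, s ≠ Set.univ ∧ H.IsIso (G.induce s) := by
  obtain ⟨f⟩ := h
  by_cases hf : Set.range f = Set.univ
  · left
    exact ⟨⟨Equiv.ofBijective f ⟨f.injective, Set.range_eq_univ.1 hf⟩, f.map_rel_iff⟩⟩
  · right
    exact ⟨Set.range f, hf, ⟨⟨Equiv.ofInjective f f.injective, f.map_rel_iff⟩⟩⟩

variable {C : Set FiniteGraph.{u}} {P : FiniteGraph.{u} → Prop}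

/-- Inside a graph without the property `P`, an induced subgraph with as few vertices as possible
among those without `P` is a minimal obstruction. -/
theorem exists_minimalObstruction_indLE
    (hC : ∀ G ∈ C, ∀ H : FiniteGraph.{u}, H.IndLE G → H ∈ C) :
    ∀ {G : FiniteGraph.{u}}, G ∈ C → ¬ P G →
      ∃ H, IsMinimalObstructionIn C P H ∧ H.IndLE G := by
  intro G
  induction hn : Nat.card G.V using Nat.strong_induction_on generalizing G with
  | _ n ih =>
    intro hG hPG
    by_cases h : ∀ s : Set G.V, s ≠ Set.univ → P (G.induce s)
    · exact ⟨G, ⟨hG, hPG, h⟩, FiniteGraph.IndLE.refl G⟩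
    · push Not at h
      obtain ⟨s, hs, hPs⟩ := h
      obtain ⟨H, hH, hle⟩ := ih _ (hn ▸ G.card_induce_lt hs) rfl (hC G hG _ (G.induce_indLE s)) hPs
      exact ⟨H, hH, hle.trans (G.induce_indLE s)⟩

/-- Comparable minimal obstructions are isomorphic. -/
theorem IsMinimalObstructionIn.isIso_of_indLE (hP : IsHereditaryOn C P)
    (hC : ∀ G ∈ C, ∀ H : FiniteGraph.{u}, H.IndLE G → H ∈ C) {G H : FiniteGraph.{u}}
    (hG : IsMinimalObstructionIn C P G) (hH : IsMinimalObstructionIn C P H) (h : H.IndLE G) :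
    H.IsIso G := by
  refine h.isIso_or.resolve_right ?_
  rintro ⟨s, hs, hiso⟩
  exact hH.2.1 (hP _ (hC _ hG.1 _ (G.induce_indLE s)) _ hH.1 hiso.indLE (hG.2.2 s hs))

/-- In a well-quasi-ordered class closed under induced subgraphs, every hereditary property is
characterised by finitely many minimal obstructions. -/
theorem IsHereditaryOn.exists_finite_obstructions (hP : IsHereditaryOn C P)
    (hC : ∀ G ∈ C, ∀ H : FiniteGraph.{u}, H.IndLE G → H ∈ C)
    (hwqo : C.PartiallyWellOrderedOn FiniteGraph.IndLE) :
    ∃ F : Set FiniteGraph.{u}, F.Finite ∧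
      (∀ H ∈ F, IsMinimalObstructionIn C P H) ∧
      (∀ G, IsMinimalObstructionIn C P G → ∃ H ∈ F, G.IsIso H) ∧
      (∀ G ∈ C, P G ↔ ∀ H ∈ F, ¬ H.IndLE G) := by
  let M : Set FiniteGraph.{u} := {G | IsMinimalObstructionIn C P G}
  let q : FiniteGraph.{u} → Quotient FiniteGraph.isoSetoid.{u} := Quotient.mk _
  obtain ⟨F, hFM, hF⟩ := Set.SurjOn.exists_bijOn_subset (Set.surjOn_image q M)
  have hrep : ∀ G, IsMinimalObstructionIn C P G → ∃ H ∈ F, G.IsIso H := by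
    intro G hG
    obtain ⟨H, hH, he⟩ := hF.surjOn ⟨G, hG, rfl⟩
    exact ⟨H, hH, Quotient.exact he.symm⟩
  refine ⟨F, ?_, fun H hH => hFM hH, hrep, fun G hG => ⟨fun hPG H hH hle => ?_, fun h => ?_⟩⟩
  · by_contra hinf
    have hinf' : F.Infinite := hinf
    let g := hinf'.natEmbedding
    obtain ⟨m, n, hmn, hle⟩ := hwqo.exists_lt (f := fun n => (g n : FiniteGraph.{u}))
      fun n => (hFM (g n).2).1
    have hiso := (hFM (g n).2).isIso_of_indLE hP hC (hFM (g m).2) hle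
    exact hmn.ne (g.injective (Subtype.ext (hF.injOn (g m).2 (g n).2 (Quotient.sound hiso))))
  · exact (hFM hH).2.1 (hP G hG H (hFM hH).1 hle hPG)
  · by_contra hPG
    obtain ⟨K, hK, hle⟩ := exists_minimalObstruction_indLE hC hG hPG
    obtain ⟨H, hH, e⟩ := hrep K hK
    exact h H hH ((FiniteGraph.IsIso.indLE (FiniteGraph.isoSetoid.symm e)).trans hle)

end Obstructions

theorem mainTheorem2 :
    (p4ExtendibleGraphs.{u}).PartiallyWellOrderedOn FiniteGraph.IndLE ∧
    ∀ P : FiniteGraph.{u} → Prop, IsHereditaryOn p4ExtendibleGraphs P →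
      ∃ F : Set FiniteGraph.{u}, F.Finite ∧
        (∀ H ∈ F, IsMinimalObstructionIn p4ExtendibleGraphs P H) ∧
        (∀ G, IsMinimalObstructionIn p4ExtendibleGraphs P G → ∃ H ∈ F, G.IsIso H) ∧
        (∀ G ∈ p4ExtendibleGraphs, P G ↔ ∀ H ∈ F, ¬ H.IndLE G) :=
  ⟨partiallyWellOrderedOn_p4ExtendibleGraphs, fun _ hP =>
    hP.exists_finite_obstructions (fun _ hG _ => mem_p4ExtendibleGraphs_of_indLE hG)
      partiallyWellOrderedOn_p4ExtendibleGraphs⟩
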